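/- Let $\mathbb{K}$ be an infinite field with algebraic closure $\overline{\mathbb{K}}$, let $d, m, n_1,\dots,n_d$ be non-negative integers, and let $G=(f_1,\dots,f_m):\mathbb{K}^{n_1}\times\cdots\times\mathbb{K}^{n_d}\to\mathbb{K}^m$ be a polynomial map such that $\operatorname{mdeg} f_i\le(1,\dots,1)$ for every $i$; that is, for every $j\in\{1,\dots,d\}$ and every choice of values of the other blocks of variables, $f_i$ is a polynomial of degree at most $1$ in the coordinates of the $j$-th block $\mathbb{K}^{n_j}$. For a subset $S$ of $\mathbb{K}^{n_1}\times\cdots\times\mathbb{K}^{n_d}=\mathbb{K}^{N}$, $N=\sum_{i=1}^d n_i$, let $$\overline{S}=\{x\in\overline{\mathbb{K}}^{N} : g(x)=0 \text{ for all } g\in\mathbb{K}[x_1,\dots,x_N] \text{ vanishing on } S\},$$ with the Zariski topology induced from $\overline{\mathbb{K}}^{N}$. Let $\mathsf{c}\in\mathbb{K}^m$ be such that $G^{-1}(\mathsf{c})\neq\varnothing$. Then every irreducible component $Z$ of $\overline{G^{-1}(\mathsf{c})}$ satisfies $$\dim Z\ \ge\ \sum_{i=1}^d n_i-2^d m .$$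 -/

import Mathlib

/-- The affine space `L ^ σ` of points with coordinates in `L`, carrying the Zariski topology. -/
def ZariskiSpace (σ L : Type*) : Type _ := σ → L

/-- The zero loci in `L ^ σ` of the ideals of the polynomial ring `L[x_s : s ∈ σ]`. -/
def algebraicSets (σ L : Type*) [Field L] : Set (Set (ZariskiSpace σ L)) :=
  {Z : Set (σ → L) | ∃ I : Ideal (MvPolynomial σ L), Z = MvPolynomial.zeroLocus L I}

theorem empty_mem_algebraicSets (σ L : Type*) [Field L] : ∅ ∈ algebraicSets σ L :=
  ⟨⊤, MvPolynomial.zeroLocus_top.symm⟩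

theorem sInter_mem_algebraicSets (σ L : Type*) [Field L] (A : Set (Set (ZariskiSpace σ L)))
    (hA : A ⊆ algebraicSets σ L) : ⋂₀ A ∈ algebraicSets σ L := by
  refine ⟨⨆ Z ∈ A, MvPolynomial.vanishingIdeal L (σ := σ) (K := L) Z, ?_⟩
  refine Set.Subset.antisymm ?_ ?_
  · refine MvPolynomial.le_zeroLocus_iff_le_vanishingIdeal.2 (iSup₂_le fun Z hZ => ?_)
    exact MvPolynomial.vanishingIdeal_anti_mono (Set.sInter_subset_of_mem hZ)
  · refine Set.subset_sInter fun Z hZ => ?_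
    obtain ⟨I, hI⟩ := hA hZ
    subst hI
    refine MvPolynomial.zeroLocus_anti_mono ?_
    exact (MvPolynomial.le_vanishingIdeal_zeroLocus I).trans
      (le_iSup₂_of_le (MvPolynomial.zeroLocus L I) hZ le_rfl)

theorem union_mem_algebraicSets (σ L : Type*) [Field L] (Y : Set (ZariskiSpace σ L))
    (hY : Y ∈ algebraicSets σ L) (Z : Set (ZariskiSpace σ L)) (hZ : Z ∈ algebraicSets σ L) :
    Y ∪ Z ∈ algebraicSets σ L := by
  obtain ⟨I, rfl⟩ := hY
  obtain ⟨J, rfl⟩ := hZ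
  refine ⟨I * J, Set.Subset.antisymm ?_ ?_⟩
  · refine Set.union_subset ?_ ?_
    · exact MvPolynomial.zeroLocus_anti_mono Ideal.mul_le_left
    · exact MvPolynomial.zeroLocus_anti_mono Ideal.mul_le_right
  · intro x h
    by_contra hx
    obtain ⟨hxI, hxJ⟩ := not_or.1 hx
    obtain ⟨p, hpx⟩ := not_forall.1 hxI
    obtain ⟨hp, hpx⟩ := Classical.not_imp.1 hpx
    obtain ⟨q, hqx⟩ := not_forall.1 hxJ
    obtain ⟨hq, hqx⟩ := Classical.not_imp.1 hqx
    have hpq := h (p * q) (Ideal.mul_mem_mul hp hq)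
    rw [map_mul] at hpq
    exact (mul_ne_zero hpx hqx) hpq

/-- The Zariski topology: the closed sets are the zero loci of ideals. -/
instance ZariskiSpace.instTopologicalSpace (σ L : Type*) [Field L] :
    TopologicalSpace (ZariskiSpace σ L) :=
  TopologicalSpace.ofClosed (algebraicSets σ L) (empty_mem_algebraicSets σ L)
    (sInter_mem_algebraicSets σ L) (union_mem_algebraicSets σ L)

theorem ZariskiSpace.isClosed_iff {σ L : Type*} [Field L] (Z : Set (ZariskiSpace σ L)) :
    IsClosed Z ↔ Z ∈ algebraicSets σ L := by
  rw [← isOpen_compl_iff]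
  change Zᶜᶜ ∈ algebraicSets σ L ↔ _
  rw [compl_compl]

/-- For `S ⊆ K ^ σ`, the set of all points with coordinates in the algebraic closure of `K` at
which every polynomial over `K` that vanishes on `S` vanishes. -/
def zariskiClosure {σ K : Type*} [Field K] (S : Set (σ → K)) :
    Set (ZariskiSpace σ (AlgebraicClosure K)) :=
  {x : σ → AlgebraicClosure K |
    ∀ p ∈ MvPolynomial.vanishingIdeal K S, MvPolynomial.aeval x p = 0}

/-- The coordinates of a point of `K ^ (n 0) × ⋯ × K ^ (n (d - 1))`, as one family. -/
def flattenPoint {K : Type*} {d : ℕ} {n : Fin d → ℕ} (v : ∀ j, Fin (n j) → K) :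
    (Σ j, Fin (n j)) → K :=
  fun p => v p.1 p.2

/-- A map `K ^ (n 0) × ⋯ × K ^ (n (d - 1)) → K ^ m` whose components are polynomials in all the
coordinates. -/
def IsPolynomialMap {K : Type*} [Field K] {d m : ℕ} {n : Fin d → ℕ}
    (G : (∀ j, Fin (n j) → K) → Fin m → K) : Prop :=
  ∀ i, ∃ P : MvPolynomial (Σ j, Fin (n j)) K,
    ∀ v, G v i = MvPolynomial.eval (flattenPoint v) P

/-- `mdeg f ≤ (e 0, …, e (d - 1))`: for every block `j`, whatever values the other blocks are
given, `f` is a polynomial of degree at most `e j` in the coordinates of the block `j`. -/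
def MultidegreeLE {K : Type*} [Field K] {d : ℕ} {n : Fin d → ℕ}
    (f : (∀ j, Fin (n j) → K) → K) (e : Fin d → ℕ) : Prop :=
  ∀ (j : Fin d) (v : ∀ j, Fin (n j) → K), ∃ P : MvPolynomial (Fin (n j)) K,
    P.totalDegree ≤ e j ∧
      ∀ x : Fin (n j) → K, f (Function.update v j x) = MvPolynomial.eval x P

/-- In particular, a function which is, in each block `j`, homogeneous of some degree `k ≤ e j`
has multidegree at most `e`. -/
theorem MultidegreeLE.of_isHomogeneous {K : Type*} [Field K] {d : ℕ} {n : Fin d → ℕ}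
    {f : (∀ j, Fin (n j) → K) → K} {e : Fin d → ℕ}
    (h : ∀ j : Fin d, ∃ k ≤ e j, ∀ v : ∀ j, Fin (n j) → K, ∃ P : MvPolynomial (Fin (n j)) K,
      P.IsHomogeneous k ∧
        ∀ x : Fin (n j) → K, f (Function.update v j x) = MvPolynomial.eval x P) :
    MultidegreeLE f e := by
  intro j v
  obtain ⟨k, hk, hP⟩ := h j
  obtain ⟨P, hPk, hPf⟩ := hP v
  exact ⟨P, hPk.totalDegree_le.trans hk, hPf⟩

/-! Fix a point v of the fibre S = G⁻¹(c). Since G is affine in each block, a displacement within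
one block stays in S exactly when it solves m linear equations whose coefficients do not involve
that block. Over the coordinate ring of an irreducible subset of S that is constant along block j,
these equations have a nontrivial polynomial solution as soon as more than m coordinates of the
block are allowed to move, and flowing along it (`sweep`) preserves irreducibility. Block j thus
contributes max(n_j - m, 0) strict inclusions (`HasPrimeChain.exists_extension`). All blocks
together put v in an irreducible B ⊆ S ending a chain of length ∑ max(n_j - m, 0) ≥ ∑ n_j - d m
(`exists_hasPrimeChain_of_isAffineAlong`), which suffices because d ≤ 2^d.

Linear functionals on the algebraic closure transfer density of S and irreducibility of its subsets
from K to the closure. A component Z contains a nonempty open subset of the closure of S; this meets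
S in some v, so Z contains the B built from v, and the closures of the chain in Z bound dim Z from
below. -/

/-! ### Polynomials affine along a set of coordinates -/

open MvPolynomial in
/-- A polynomial of total degree at most one is, as a function, affine. -/
theorem MvPolynomial.exists_linearMap_eval_eq_add_of_totalDegree_le_one {τ K : Type*} [Field K]
    (Q : MvPolynomial τ K) (hQ : Q.totalDegree ≤ 1) :
    ∃ (a : K) (l : (τ → K) →ₗ[K] K), ∀ z, eval z Q = a + l z := by
  suffices h : ∀ u ∈ Q.support, ∃ (a : K) (l : (τ → K) →ₗ[K] K),
      ∀ z, eval z (monomial u (coeff u Q)) = a + l z by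
    choose! a l h using h
    refine ⟨∑ u ∈ Q.support, a u, ∑ u ∈ Q.support, l u, fun z => ?_⟩
    conv_lhs => rw [Q.as_sum]
    rw [map_sum, Finset.sum_congr rfl fun u hu => h u hu z]
    simp [Finset.sum_add_distrib]
  intro u hu
  have hu1 : u.degree ≤ 1 := (le_totalDegree hu).trans hQ
  rcases Nat.le_one_iff_eq_zero_or_eq_one.1 hu1 with h0 | h1
  · rw [Finsupp.degree_eq_zero_iff] at h0
    subst h0
    exact ⟨coeff 0 Q, 0, fun z => by simp⟩
  · obtain ⟨i, rfl⟩ : u ∈ Set.range fun i => Finsupp.single i 1 := by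
      rw [Finsupp.range_single_one]
      exact h1
    exact ⟨0, coeff (Finsupp.single i 1) Q • LinearMap.proj i, fun z => by simp [eval_monomial]⟩

/-- The values of `P` at `x` and at `x + y` differ by a linear function of `y`, as long as only
the coordinates in `U` are moved. -/
def IsAffineAlong {σ K : Type*} [Field K] (U : Finset σ) (P : MvPolynomial σ K) : Prop :=
  ∀ x : σ → K, ∃ l : (σ → K) →ₗ[K] K, ∀ y : σ → K, (∀ p, p ∉ U → y p = 0) →
    MvPolynomial.eval (x + y) P = MvPolynomial.eval x P + l y

/-- The difference quotient `P (x + e_p) - P (x)`. -/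
noncomputable def unitDifference {σ K : Type*} [Field K] [DecidableEq σ] (p : σ)
    (P : MvPolynomial σ K) : MvPolynomial σ K :=
  MvPolynomial.bind₁ (fun q => MvPolynomial.X q + MvPolynomial.C (Pi.single p 1 q)) P - P

theorem eval_unitDifference {σ K : Type*} [Field K] [DecidableEq σ] (p : σ)
    (P : MvPolynomial σ K) (x : σ → K) :
    MvPolynomial.eval x (unitDifference p P) =
      MvPolynomial.eval (x + Pi.single p 1) P - MvPolynomial.eval x P := by
  rw [unitDifference, map_sub]
  congr 1
  change MvPolynomial.eval₂Hom _ x _ = _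
  rw [MvPolynomial.eval₂Hom_bind₁]
  congr 2
  ext q
  simp

/-- The linear part at x is determined by its values on unit vectors, so its coefficients are
polynomial in x, although `IsAffineAlong` only provides a linear map for each x separately. -/
theorem IsAffineAlong.eval_add {σ K : Type*} [Field K] [DecidableEq σ] {U : Finset σ}
    {P : MvPolynomial σ K} (h : IsAffineAlong U P) (x y : σ → K) (hy : ∀ p, p ∉ U → y p = 0) :
    MvPolynomial.eval (x + y) P =
      MvPolynomial.eval x P + ∑ p ∈ U, y p * MvPolynomial.eval x (unitDifference p P) := by
  obtain ⟨l, hl⟩ := h x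
  have h1 : ∀ p ∈ U, MvPolynomial.eval x (unitDifference p P) = l (Pi.single p 1) := by
    intro p hp
    rw [eval_unitDifference, hl, add_sub_cancel_left]
    intro q hq
    exact Pi.single_eq_of_ne (by rintro rfl; exact hq hp) _
  have h2 : y = ∑ p ∈ U, y p • (Pi.single p 1 : σ → K) := by
    ext q
    rw [Finset.sum_apply]
    by_cases hq : q ∈ U
    · rw [Finset.sum_eq_single_of_mem q hq]
      · simp
      · intro b _ hb
        simp [Pi.single_eq_of_ne hb.symm]
    · rw [hy q hq, Finset.sum_eq_zero]
      intro b hb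
      have : q ≠ b := by rintro rfl; exact hq hb
      simp [Pi.single_eq_of_ne this]
  rw [hl y hy, Finset.sum_congr rfl fun p hp => by rw [h1 p hp]]
  congr 1
  conv_lhs => rw [h2]
  simp

/-- The differences along `U` do not depend on the coordinates in `U`. -/
theorem IsAffineAlong.eval_unitDifference_add {σ K : Type*} [Field K] [DecidableEq σ]
    {U : Finset σ} {P : MvPolynomial σ K} (h : IsAffineAlong U P) (x y : σ → K)
    (hy : ∀ p, p ∉ U → y p = 0) {p : σ} (hp : p ∈ U) :
    MvPolynomial.eval (x + y) (unitDifference p P) =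
      MvPolynomial.eval x (unitDifference p P) := by
  obtain ⟨l, hl⟩ := h x
  have hs : ∀ q, q ∉ U → (Pi.single p 1 : σ → K) q = 0 := fun q hq =>
    Pi.single_eq_of_ne (by rintro rfl; exact hq hp) _
  rw [eval_unitDifference, eval_unitDifference, add_assoc, hl y hy, hl _ hs, hl (y + _), map_add]
  · ring
  · intro q hq
    rw [Pi.add_apply, hy q hq, hs q hq, add_zero]

/-! ### Prime chains and sweeping along a vector field -/

/-- There is a chain of `r + 1` sets with prime vanishing ideals, the last of them `A`, in which
neighbours are separated by a polynomial. -/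
inductive HasPrimeChain {σ K : Type*} [Field K] : ℕ → Set (σ → K) → Prop
  | zero {A : Set (σ → K)} (hA : (MvPolynomial.vanishingIdeal K A).IsPrime) : HasPrimeChain 0 A
  | succ {r : ℕ} {A B : Set (σ → K)} {f : MvPolynomial σ K} (h : HasPrimeChain r A) (hAB : A ⊆ B)
      (hB : (MvPolynomial.vanishingIdeal K B).IsPrime)
      (hfA : f ∈ MvPolynomial.vanishingIdeal K A) (hfB : f ∉ MvPolynomial.vanishingIdeal K B) :
      HasPrimeChain (r + 1) B

theorem HasPrimeChain.isPrime {σ K : Type*} [Field K] {r : ℕ} {A : Set (σ → K)}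
    (h : HasPrimeChain r A) : (MvPolynomial.vanishingIdeal K A).IsPrime := by
  cases h <;> assumption

/-- The set swept out by moving the points of `A` along the polynomial vector field `w`. -/
def sweep {σ K : Type*} [Field K] (A : Set (σ → K)) (w : σ → MvPolynomial σ K) : Set (σ → K) :=
  {y | ∃ x ∈ A, ∃ s : K, y = x + s • fun p => MvPolynomial.eval x (w p)}

theorem subset_sweep {σ K : Type*} [Field K] (A : Set (σ → K)) (w : σ → MvPolynomial σ K) :
    A ⊆ sweep A w :=
  fun x hx => ⟨x, hx, 0, by simp⟩

theorem mem_vanishingIdeal_iff_eval {σ K : Type*} [Field K] {A : Set (σ → K)}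
    {f : MvPolynomial σ K} :
    f ∈ MvPolynomial.vanishingIdeal K A ↔ ∀ x ∈ A, MvPolynomial.eval x f = 0 :=
  Iff.rfl

-- The sweep is the image of A × K. If f and g are nonzero at times s and t of two trajectories,
-- primality of the ideal of A gives one z in A whose line carries both nonvanishing values; on that
-- line f and g become univariate polynomials with zero product, as K is infinite.
open MvPolynomial in
theorem isPrime_vanishingIdeal_sweep {σ K : Type*} [Field K] [Infinite K] {A : Set (σ → K)}
    (w : σ → MvPolynomial σ K) (hA : (vanishingIdeal K A).IsPrime) :
    (vanishingIdeal K (sweep A w)).IsPrime := by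
  refine ⟨fun h => hA.ne_top (top_le_iff.1 (h ▸ vanishingIdeal_anti_mono (subset_sweep A w))), ?_⟩
  intro f g hfg
  by_contra hcon
  obtain ⟨hf, hg⟩ := not_or.1 hcon
  -- the restriction of a polynomial to the lines, and to a fixed time
  let line (x : σ → K) (q : σ) : Polynomial K :=
    Polynomial.C (x q) + Polynomial.X * Polynomial.C (eval x (w q))
  have hline (x : σ → K) (s : K) (f : MvPolynomial σ K) :
      (aeval (line x) f).eval s = eval (x + s • fun p => eval x (w p)) f := by
    change ((Polynomial.evalRingHom s).comp (aeval (line x)).toRingHom) f = _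
    congr 1
    ext q
    · simp
    · simp [line, mul_comm s]
  let shift (s : K) (q : σ) : MvPolynomial σ K := X q + C s * w q
  have hshift (x : σ → K) (s : K) (f : MvPolynomial σ K) :
      eval x (bind₁ (shift s) f) = eval (x + s • fun p => eval x (w p)) f := by
    change MvPolynomial.eval₂Hom _ x _ = _
    rw [MvPolynomial.eval₂Hom_bind₁]
    congr 2
    ext q
    simp [shift]
  rw [mem_vanishingIdeal_iff_eval] at hf hg hfg
  push Not at hf hg
  obtain ⟨_, ⟨x, hx, s, rfl⟩, hfx⟩ := hf
  obtain ⟨_, ⟨y, hy, t, rfl⟩, hgy⟩ := hg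
  have h1 : bind₁ (shift s) f ∉ vanishingIdeal K A := fun h =>
    hfx (by rw [← hshift]; exact mem_vanishingIdeal_iff_eval.1 h x hx)
  have h2 : bind₁ (shift t) g ∉ vanishingIdeal K A := fun h =>
    hgy (by rw [← hshift]; exact mem_vanishingIdeal_iff_eval.1 h y hy)
  have h3 : bind₁ (shift s) f * bind₁ (shift t) g ∉ vanishingIdeal K A := fun h =>
    (hA.mem_or_mem h).elim h1 h2
  rw [mem_vanishingIdeal_iff_eval] at h3
  push Not at h3
  obtain ⟨z, hz, hfgz⟩ := h3
  rw [map_mul, hshift, hshift, ← hline, ← hline] at hfgz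
  have h4 : aeval (line z) f * aeval (line z) g = 0 := by
    refine Polynomial.funext fun u => ?_
    rw [Polynomial.eval_mul, hline, hline, ← map_mul, Polynomial.eval_zero]
    exact hfg _ ⟨z, hz, u, rfl⟩
  rcases mul_eq_zero.1 h4 with h | h <;> simp [h] at hfgz

/-! ### Growing chains inside a fibre -/

/-- More linear forms than equations over a quotient ring have a common nontrivial zero. -/
theorem exists_mem_ideal_of_card_lt {R σ : Type*} [CommRing R] [DecidableEq σ] (I : Ideal R)
    (hI : I ≠ ⊤) {m : ℕ}
    (S : Finset σ) (hS : m < S.card) (b : Fin m → σ → R) :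
    ∃ w : σ → R, (∀ p, p ∉ S → w p = 0) ∧ (∃ k ∈ S, w k ∉ I) ∧
      ∀ i, ∑ p ∈ S, w p * b i p ∈ I := by
  have : Nontrivial (R ⧸ I) := Ideal.Quotient.nontrivial_iff.2 hI
  let M : (S → R ⧸ I) →ₗ[R ⧸ I] Fin m → R ⧸ I :=
    LinearMap.pi fun i => ∑ p : S, Ideal.Quotient.mk I (b i p) • LinearMap.proj p
  -- An injective linear map between finite free modules cannot lower the rank over any nontrivial
  -- commutative ring, so I need only be proper.
  have hM : ¬ Function.Injective M := fun h => by
    have := card_le_of_injective _ M h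
    simp at this
    omega
  rw [← LinearMap.ker_eq_bot, Submodule.eq_bot_iff] at hM
  push Not at hM
  obtain ⟨u, hu, hu0⟩ := hM
  choose v hv using fun p => Ideal.Quotient.mk_surjective (u p)
  obtain ⟨k, hk⟩ := Function.ne_iff.1 hu0
  refine ⟨fun p => if h : p ∈ S then v ⟨p, h⟩ else 0, fun p hp => dif_neg hp,
    ⟨k, k.2, ?_⟩, fun i => ?_⟩
  · beta_reduce
    rw [dif_pos k.2, ← Ideal.Quotient.eq_zero_iff_mem, hv]
    exact hk
  · rw [← Ideal.Quotient.eq_zero_iff_mem, map_sum, ← Finset.sum_coe_sort S]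
    have := congrFun (LinearMap.mem_ker.1 hu) i
    simp only [M, LinearMap.pi_apply, LinearMap.sum_apply, LinearMap.smul_apply,
      LinearMap.proj_apply, smul_eq_mul, Pi.zero_apply] at this
    rw [← this]
    refine Finset.sum_congr rfl fun p _ => ?_
    simp [hv, mul_comm]

open MvPolynomial in
/-- In a fibre of polynomials that are affine along `U`, a set which is constant along `U` extends
along the coordinates in `S ⊆ U`, raising the chain length by `S.card - m`. -/
theorem HasPrimeChain.exists_extension {σ K : Type*} [Field K] [Infinite K] [DecidableEq σ]
    {m : ℕ} (P : Fin m → MvPolynomial σ K) (c : Fin m → K) (U : Finset σ)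
    (hP : ∀ i, IsAffineAlong U (P i)) (v : σ → K) {r : ℕ} {A : Set (σ → K)}
    (hA : HasPrimeChain r A) (hAc : ∀ x ∈ A, ∀ i, eval x (P i) = c i)
    (hAU : ∀ x ∈ A, ∀ p ∈ U, x p = v p) (S : Finset σ) (hS : S ⊆ U) :
    ∃ B, A ⊆ B ∧ HasPrimeChain (r + (S.card - m)) B ∧ (∀ x ∈ B, ∀ i, eval x (P i) = c i) ∧
      ∀ y ∈ B, ∃ x ∈ A, ∀ p, p ∉ S → y p = x p := by
  induction hs : S.card generalizing S with
  | zero => exact ⟨A, subset_rfl, by simpa using hA, hAc, fun y hy => ⟨y, hy, fun _ _ => rfl⟩⟩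
  | succ k ih =>
    by_cases hm : k + 1 ≤ m
    · refine ⟨A, subset_rfl, ?_, hAc, fun y hy => ⟨y, hy, fun _ _ => rfl⟩⟩
      rwa [Nat.sub_eq_zero_of_le hm]
    -- The equations are solved over A, before the induction hypothesis is used: this decides which
    -- q to erase, so that q is still frozen at `v q` on B.
    obtain ⟨w, hw0, ⟨q, hqS, hq⟩, hwI⟩ := exists_mem_ideal_of_card_lt _ hA.isPrime.ne_top S
      (by omega : m < S.card) fun i p => unitDifference p (P i)
    obtain ⟨B, hAB, hB, hBc, hBA⟩ := ih (S.erase q) ((S.erase_subset q).trans hS)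
      (by rw [Finset.card_erase_of_mem hqS, hs]; rfl)
    -- the vector field `w`, pulled back along the projection which resets the coordinates in `U`
    let ρ (p : σ) : MvPolynomial σ K := if p ∈ U then C (v p) else X p
    have hρ {y x : σ → K} (hx : x ∈ A) (hyx : ∀ p, p ∉ S.erase q → y p = x p)
        (f : MvPolynomial σ K) : eval y (bind₁ ρ f) = eval x f := by
      change MvPolynomial.eval₂Hom _ y _ = _
      rw [MvPolynomial.eval₂Hom_bind₁]
      congr 2
      ext p
      by_cases hp : p ∈ U
      · simp [ρ, hp, hAU x hx p hp]
      · have : p ∉ S.erase q := fun h => hp (hS (Finset.mem_of_mem_erase h))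
        simp [ρ, hp, hyx p this]
    let w' (p : σ) : MvPolynomial σ K := bind₁ ρ (w p)
    have hsupp (x : σ → K) (s : K) : ∀ p, p ∉ S → (s • fun p => eval x (w p)) p = 0 :=
      fun p hp => by simp [hw0 p hp]
    refine ⟨sweep B w', hAB.trans (subset_sweep B w'), ?_, ?_, ?_⟩
    · have hlen : r + (k + 1 - m) = r + (k - m) + 1 := by omega
      rw [hlen]
      -- Coordinate q is constant on B, but the flow changes it at a point of A where `w q` is
      -- nonzero.
      refine HasPrimeChain.succ (f := X q - C (v q)) hB (subset_sweep B w')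
        (isPrime_vanishingIdeal_sweep w' hB.isPrime) ?_ ?_
      · rw [mem_vanishingIdeal_iff_eval]
        intro y hy
        obtain ⟨x, hx, hyx⟩ := hBA y hy
        simp [hyx q (Finset.notMem_erase q S), hAU x hx q (hS hqS)]
      · rw [mem_vanishingIdeal_iff_eval] at hq ⊢
        push Not at hq ⊢
        obtain ⟨x, hx, hxq⟩ := hq
        refine ⟨_, ⟨x, hAB hx, 1, rfl⟩, ?_⟩
        simpa [w', hρ hx fun _ _ => rfl, hAU x hx q (hS hqS)] using hxq
    · rintro _ ⟨y, hy, s, rfl⟩ i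
      obtain ⟨x, hx, hyx⟩ := hBA y hy
      simp only [w', hρ hx hyx]
      rw [(hP i).eval_add _ _ fun p hp => hsupp x s p fun h => hp (hS h), hBc y hy i]
      -- A point y of B differs from x in A only along U, where the coefficients of the equations
      -- are constant; hence w, solved on A, also works on B.
      have hD : ∀ p ∈ U, eval y (unitDifference p (P i)) = eval x (unitDifference p (P i)) := by
        intro p hp
        have := (hP i).eval_unitDifference_add x (y - x) (fun p hp => ?_) hp
        · rwa [add_sub_cancel] at this
        · rw [Pi.sub_apply, hyx p fun h => hp (hS (Finset.mem_of_mem_erase h)), sub_self]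
      have h0 := mem_vanishingIdeal_iff_eval.1 (hwI i) x hx
      rw [map_sum] at h0
      rw [add_eq_left, ← Finset.sum_subset hS fun p _ hp => by rw [hsupp x s p hp, zero_mul],
        ← mul_zero s, ← h0, Finset.mul_sum]
      refine Finset.sum_congr rfl fun p hp => ?_
      rw [hD p (hS hp), map_mul, Pi.smul_apply, smul_eq_mul, mul_assoc]
    · rintro _ ⟨y, hy, s, rfl⟩
      obtain ⟨x, hx, hyx⟩ := hBA y hy
      refine ⟨x, hx, fun p hp => ?_⟩
      simp only [w', hρ hx hyx]
      rw [Pi.add_apply, hsupp x s p hp, add_zero, hyx p fun h => hp (Finset.mem_of_mem_erase h)]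

open MvPolynomial in
/-- Every point of a fibre of polynomials that are affine along each of the disjoint blocks
`U j` lies in a subset of the fibre with a long prime chain. -/
theorem exists_hasPrimeChain_of_isAffineAlong {σ K ι : Type*} [Field K] [Infinite K]
    [DecidableEq σ] [DecidableEq ι] {m : ℕ} (P : Fin m → MvPolynomial σ K) (c : Fin m → K)
    (U : ι → Finset σ) (hU : Pairwise fun i j => Disjoint (U i) (U j))
    (hP : ∀ j i, IsAffineAlong (U j) (P i)) (v : σ → K) (hv : ∀ i, eval v (P i) = c i)
    (J : Finset ι) :
    ∃ B, v ∈ B ∧ HasPrimeChain (∑ j ∈ J, ((U j).card - m)) B ∧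
      (∀ x ∈ B, ∀ i, eval x (P i) = c i) ∧ ∀ x ∈ B, ∀ j, j ∉ J → ∀ p ∈ U j, x p = v p := by
  induction J using Finset.induction_on with
  | empty =>
    exact ⟨{v}, rfl, .zero inferInstance, by simpa using hv, by simp⟩
  | insert j J hj ih =>
    obtain ⟨A, hvA, hA, hAc, hAU⟩ := ih
    obtain ⟨B, hAB, hB, hBc, hBA⟩ := hA.exists_extension P c (U j) (hP j) v hAc
      (fun x hx p hp => hAU x hx j hj p hp) (U j) subset_rfl
    refine ⟨B, hAB hvA, ?_, hBc, fun y hy k hk p hp => ?_⟩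
    · rwa [Finset.sum_insert hj, add_comm]
    · obtain ⟨x, hx, hyx⟩ := hBA y hy
      rw [Finset.mem_insert, not_or] at hk
      rw [hyx p (Finset.disjoint_left.1 (hU hk.1) hp), hAU x hx k hk.2 p hp]

/-! ### Descent of coefficients to the base field -/

/-- Apply a linear functional to the coefficients of a polynomial. -/
noncomputable def mapCoeff {σ K L : Type*} [Field K] [Field L] [Algebra K L] (φ : L →ₗ[K] K)
    (f : MvPolynomial σ L) : MvPolynomial σ K :=
  ∑ u ∈ f.support, MvPolynomial.monomial u (φ (MvPolynomial.coeff u f))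

theorem eval_mapCoeff {σ K L : Type*} [Field K] [Field L] [Algebra K L] (φ : L →ₗ[K] K)
    (f : MvPolynomial σ L) (x : σ → K) :
    MvPolynomial.eval x (mapCoeff φ f) = φ (MvPolynomial.eval (fun p => algebraMap K L (x p)) f) := by
  conv_rhs => rw [f.as_sum]
  rw [mapCoeff, map_sum, map_sum, map_sum]
  refine Finset.sum_congr rfl fun u _ => ?_
  rw [MvPolynomial.eval_monomial, MvPolynomial.eval_monomial, Finsupp.prod, Finsupp.prod]
  simp_rw [← map_pow]
  rw [← map_prod, mul_comm (MvPolynomial.coeff u f), ← Algebra.smul_def, map_smul, smul_eq_mul,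
    mul_comm]

/-- A polynomial over `L` vanishing on a set of `K`-rational points vanishes wherever all
polynomials over `K` vanishing on that set do. -/
theorem eval_eq_zero_of_forall_aeval_eq_zero {σ K L : Type*} [Field K] [Field L] [Algebra K L]
    (S : Set (σ → K)) (f : MvPolynomial σ L)
    (hf : ∀ y ∈ S, MvPolynomial.eval (fun p => algebraMap K L (y p)) f = 0) (x : σ → L)
    (hx : ∀ p ∈ MvPolynomial.vanishingIdeal K S, MvPolynomial.aeval x p = 0) :
    MvPolynomial.eval x f = 0 := by
  classical
  -- Write f = ∑ b_i f_i with f_i over K. At a K-rational point the values of the f_i are the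
  -- coordinates of the value of f, so every f_i vanishes on S.
  let b := Module.Basis.ofVectorSpace K L
  let I := f.support.biUnion fun u => (b.repr (MvPolynomial.coeff u f)).support
  have hg (i) : MvPolynomial.aeval x (mapCoeff (b.coord i) f) = 0 := hx _ <|
    mem_vanishingIdeal_iff_eval.2 fun y hy => by rw [eval_mapCoeff, hf y hy, map_zero]
  have hc : ∀ u ∈ f.support, MvPolynomial.coeff u f =
      ∑ i ∈ I, b i * algebraMap K L (b.coord i (MvPolynomial.coeff u f)) := by
    intro u hu
    conv_lhs => rw [← b.linearCombination_repr (MvPolynomial.coeff u f)]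
    have hI : (b.repr (MvPolynomial.coeff u f)).support ⊆ I :=
      Finset.subset_biUnion_of_mem (fun u => (b.repr (MvPolynomial.coeff u f)).support) hu
    rw [Finsupp.linearCombination_apply,
      Finsupp.sum_of_support_subset _ hI (fun i a => a • b i) fun i _ => zero_smul _ _]
    refine Finset.sum_congr rfl fun i _ => ?_
    rw [Algebra.smul_def, mul_comm, Module.Basis.coord_apply]
  calc MvPolynomial.eval x f
      = ∑ u ∈ f.support, MvPolynomial.coeff u f * ∏ p ∈ u.support, x p ^ u p :=
        MvPolynomial.eval_eq x f
    _ = ∑ i ∈ I, b i * MvPolynomial.aeval x (mapCoeff (b.coord i) f) := by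
        rw [Finset.sum_congr rfl fun u hu => by rw [hc u hu, Finset.sum_mul], Finset.sum_comm]
        refine Finset.sum_congr rfl fun i _ => ?_
        rw [mapCoeff, map_sum, Finset.mul_sum]
        refine Finset.sum_congr rfl fun u _ => ?_
        rw [MvPolynomial.aeval_monomial, mul_assoc]
        rfl
    _ = 0 := by simp [hg]

/-! ### Irreducibility and dimension in the Zariski topology -/

/-- The points of `L ^ σ` coming from a set of points of `K ^ σ`. -/
def rationalPoints {σ K : Type*} (L : Type*) [Field K] [Field L] [Algebra K L]
    (A : Set (σ → K)) : Set (ZariskiSpace σ L) :=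
  {x | ∃ y ∈ A, x = fun p => algebraMap K L (y p)}

theorem isClosed_setOf_eval_eq_zero {σ L : Type*} [Field L] (f : MvPolynomial σ L) :
    IsClosed {x : ZariskiSpace σ L | MvPolynomial.eval x f = 0} := by
  rw [ZariskiSpace.isClosed_iff]
  refine ⟨Ideal.span {f}, ?_⟩
  rw [MvPolynomial.zeroLocus_span]
  simp only [Set.mem_singleton_iff, forall_eq]
  rfl

theorem exists_eval_ne_zero_of_isOpen {σ L : Type*} [Field L] {u : Set (ZariskiSpace σ L)}
    (hu : IsOpen u) {x : ZariskiSpace σ L} (hx : x ∈ u) :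
    ∃ f : MvPolynomial σ L, MvPolynomial.eval x f ≠ 0 ∧
      ∀ y : ZariskiSpace σ L, MvPolynomial.eval y f ≠ 0 → y ∈ u := by
  obtain ⟨I, hI⟩ := (ZariskiSpace.isClosed_iff uᶜ).1 hu.isClosed_compl
  obtain ⟨f, hf, hfx⟩ : ∃ f ∈ I, MvPolynomial.eval x f ≠ 0 := by
    by_contra! h
    have : x ∈ uᶜ := by
      rw [hI]
      exact h
    exact this hx
  refine ⟨f, hfx, fun y hy => ?_⟩
  by_contra hyu
  have : y ∈ uᶜ := hyu
  rw [hI] at this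
  exact hy (this f hf)

/-- A closed set is recovered from its vanishing ideal, so closed sets embed, order reversed, into
the ideals of a Noetherian ring. -/
instance ZariskiSpace.noetherianSpace {σ L : Type*} [Field L] [Finite σ] :
    TopologicalSpace.NoetherianSpace (ZariskiSpace σ L) := by
  refine ((TopologicalSpace.noetherianSpace_TFAE (ZariskiSpace σ L)).out 0 1).2 ?_
  let V (Z : TopologicalSpace.Closeds (ZariskiSpace σ L)) : Ideal (MvPolynomial σ L) :=
    MvPolynomial.vanishingIdeal L (K := L) (Z : Set (ZariskiSpace σ L))
  have hV (Z : TopologicalSpace.Closeds (ZariskiSpace σ L)) : (Z : Set (ZariskiSpace σ L)) = MvPolynomial.zeroLocus L (V Z) := by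
    obtain ⟨I, hI⟩ := (ZariskiSpace.isClosed_iff _).1 Z.isClosed
    refine Set.Subset.antisymm (MvPolynomial.zeroLocus_vanishingIdeal_le _) ?_
    conv_rhs => rw [hI]
    refine MvPolynomial.zeroLocus_anti_mono ?_
    have := MvPolynomial.le_vanishingIdeal_zeroLocus (K := L) I
    rwa [← hI] at this
  have hanti : StrictAnti V := by
    refine Antitone.strictAnti_of_injective
      (fun Y Z h => MvPolynomial.vanishingIdeal_anti_mono h) fun Y Z h => ?_
    exact SetLike.coe_injective (by rw [hV Y, hV Z, h])
  exact hanti.wellFoundedLT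

/-- The rational points with coordinates in a set with prime vanishing ideal are irreducible. -/
theorem isIrreducible_preimage_rationalPoints {σ K L X : Type*} [Field K] [Field L] [Algebra K L]
    [TopologicalSpace X] {e : X → ZariskiSpace σ L} (he : Topology.IsInducing e)
    {A : Set (σ → K)} (hA : (MvPolynomial.vanishingIdeal K A).IsPrime)
    (hAe : rationalPoints L A ⊆ Set.range e) : IsIrreducible (e ⁻¹' rationalPoints L A) := by
  -- A nonzero value in L is detected by some K-linear functional, which turns f into a polynomial
  -- over K that is nonzero at the same point; primality over K then applies.
  have hsep (f : MvPolynomial σ L) (y : σ → K) (hy : y ∈ A)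
      (hf : MvPolynomial.eval (fun p => algebraMap K L (y p)) f ≠ 0) :
      ∃ φ : L →ₗ[K] K, mapCoeff φ f ∉ MvPolynomial.vanishingIdeal K A := by
    obtain ⟨φ, hφ⟩ : ∃ φ : L →ₗ[K] K, φ (MvPolynomial.eval (fun p => algebraMap K L (y p)) f) ≠ 0 := by
      by_contra! h
      exact hf ((Module.forall_dual_apply_eq_zero_iff K _).1 h)
    refine ⟨φ, fun h => hφ ?_⟩
    rw [← eval_mapCoeff]
    exact mem_vanishingIdeal_iff_eval.1 h y hy
  constructor
  · obtain ⟨y, hy⟩ : A.Nonempty := by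
      rw [Set.nonempty_iff_ne_empty]
      rintro rfl
      exact hA.ne_top MvPolynomial.vanishingIdeal_empty
    obtain ⟨x, hx⟩ := hAe ⟨y, hy, rfl⟩
    exact ⟨x, y, hy, hx⟩
  · intro u v hu hv hAu hAv
    obtain ⟨u', hu', rfl⟩ := he.isOpen_iff.1 hu
    obtain ⟨v', hv', rfl⟩ := he.isOpen_iff.1 hv
    obtain ⟨x, ⟨y, hy, hxy⟩, hx⟩ := hAu
    obtain ⟨x', ⟨y', hy', hxy'⟩, hx'⟩ := hAv
    obtain ⟨f, hfx, hf⟩ := exists_eval_ne_zero_of_isOpen hu' hx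
    obtain ⟨g, hgx, hg⟩ := exists_eval_ne_zero_of_isOpen hv' hx'
    rw [hxy] at hfx
    rw [hxy'] at hgx
    obtain ⟨φ, hφ⟩ := hsep f y hy hfx
    obtain ⟨ψ, hψ⟩ := hsep g y' hy' hgx
    have hmul : mapCoeff φ f * mapCoeff ψ g ∉ MvPolynomial.vanishingIdeal K A := fun h =>
      (hA.mem_or_mem h).elim hφ hψ
    rw [mem_vanishingIdeal_iff_eval] at hmul
    push Not at hmul
    obtain ⟨z, hz, hfgz⟩ := hmul
    rw [map_mul, eval_mapCoeff, eval_mapCoeff] at hfgz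
    obtain ⟨t, ht⟩ := hAe ⟨z, hz, rfl⟩
    refine ⟨t, ⟨z, hz, ht⟩, ?_, ?_⟩
    · refine hf _ fun h => hfgz ?_
      rw [ht] at h
      rw [h, map_zero, zero_mul]
    · refine hg _ fun h => hfgz ?_
      rw [ht] at h
      rw [h, map_zero, mul_zero]

/-- The separating polynomials, read over L, cut out closed sets and so keep the closures distinct.
A general inducing map e allows X to be a component, a subspace of a subspace. -/
theorem HasPrimeChain.exists_le_height {σ K L X : Type*} [Field K] [Field L] [Algebra K L]
    [TopologicalSpace X] {e : X → ZariskiSpace σ L} (he : Topology.IsInducing e)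
    {r : ℕ} {A : Set (σ → K)} (h : HasPrimeChain r A)
    (hAe : rationalPoints L A ⊆ Set.range e) :
    ∃ Y : TopologicalSpace.IrreducibleCloseds X,
      (Y : Set X) = closure (e ⁻¹' rationalPoints L A) ∧ (r : ℕ∞) ≤ Order.height Y := by
  induction h with
  | zero hA =>
    exact ⟨⟨_, (isIrreducible_preimage_rationalPoints he hA hAe).closure, isClosed_closure⟩, rfl,
      zero_le⟩
  | @succ r A B f hA hAB hB hfA hfB ih =>
    have hsub : rationalPoints L A ⊆ rationalPoints L B := fun _ ⟨y, hy, h⟩ => ⟨y, hAB hy, h⟩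
    obtain ⟨Y, hY, hYr⟩ := ih (hsub.trans hAe)
    refine ⟨⟨_, (isIrreducible_preimage_rationalPoints he hB hAe).closure, isClosed_closure⟩, rfl,
      ?_⟩
    push_cast
    refine (add_le_add_left hYr 1).trans (Order.height_add_one_le ?_)
    have hev (y : σ → K) : MvPolynomial.eval (fun p => algebraMap K L (y p))
        (MvPolynomial.map (algebraMap K L) f) = algebraMap K L (MvPolynomial.eval y f) := by
      rw [MvPolynomial.eval_map]
      exact (MvPolynomial.eval₂_comp (algebraMap K L) y f).symm
    rw [← SetLike.coe_ssubset_coe, hY]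
    refine ⟨closure_mono (Set.preimage_mono hsub), fun hBA => ?_⟩
    rw [mem_vanishingIdeal_iff_eval] at hfA hfB
    push Not at hfB
    obtain ⟨y, hy, hfy⟩ := hfB
    obtain ⟨x, hx⟩ := hAe ⟨y, hy, rfl⟩
    have hxA := hBA (subset_closure (show x ∈ e ⁻¹' rationalPoints L B from ⟨y, hy, hx⟩))
    have hcl := (isClosed_setOf_eval_eq_zero (MvPolynomial.map (algebraMap K L) f)).preimage
      he.continuous
    have : MvPolynomial.eval (e x) (MvPolynomial.map (algebraMap K L) f) = 0 := by
      refine closure_minimal ?_ hcl hxA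
      rintro t ⟨z, hz, ht⟩
      change MvPolynomial.eval (e t) (MvPolynomial.map (algebraMap K L) f) = 0
      rw [ht, hev, hfA z hz, map_zero]
    rw [hx, hev] at this
    exact hfy ((map_eq_zero _).1 this)

theorem rationalPoints_subset_zariskiClosure {σ K : Type*} [Field K] {A S : Set (σ → K)}
    (h : A ⊆ S) : rationalPoints (AlgebraicClosure K) A ⊆ zariskiClosure S := by
  rintro _ ⟨y, hy, rfl⟩ p hp
  have := MvPolynomial.aeval_algebraMap_apply (AlgebraicClosure K) y p
  rw [show (fun q => algebraMap K (AlgebraicClosure K) (y q)) = algebraMap K _ ∘ y from rfl, this,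
    hp y (h hy), map_zero]

/-- Every irreducible component of the Zariski closure of `S` contains every subset of `S` with a
prime vanishing ideal through a suitable point of `S`. -/
theorem exists_mem_rationalPoints_subset_of_mem_irreducibleComponents {σ K : Type*} [Field K]
    [Finite σ] (S : Set (σ → K)) (Z : Set (zariskiClosure S))
    (hZ : Z ∈ irreducibleComponents (zariskiClosure S)) :
    ∃ v ∈ S, ∀ A ⊆ S, v ∈ A → (MvPolynomial.vanishingIdeal K A).IsPrime →
      Subtype.val ⁻¹' rationalPoints (AlgebraicClosure K) A ⊆ Z := by
  -- In a Noetherian space a component contains a nonempty open set; by density it contains a point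
  -- v of S. An irreducible set through v then lies in the closure of its part in o, hence in Z.
  obtain ⟨o, ho, ⟨x, hx⟩, hoZ⟩ :=
    TopologicalSpace.NoetherianSpace.exists_isOpen_nonempty_subset_irreducibleComponent Z hZ
  obtain ⟨u, hu, rfl⟩ := isOpen_induced_iff.1 ho
  obtain ⟨f, hfx, hf⟩ := exists_eval_ne_zero_of_isOpen hu hx
  obtain ⟨v, hv, hfv⟩ : ∃ v ∈ S, MvPolynomial.eval
      (fun p => algebraMap K (AlgebraicClosure K) (v p)) f ≠ 0 := by
    by_contra! h
    exact hfx (eval_eq_zero_of_forall_aeval_eq_zero S f h _ x.2)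
  refine ⟨v, hv, fun A hAS hvA hA => ?_⟩
  have hirr := isIrreducible_preimage_rationalPoints (L := AlgebraicClosure K)
    (e := (Subtype.val : zariskiClosure S → _)) Topology.IsInducing.subtypeVal hA
    ((rationalPoints_subset_zariskiClosure hAS).trans Subtype.range_coe.ge)
  have hmeet : (Subtype.val ⁻¹' rationalPoints (AlgebraicClosure K) A ∩
      (Subtype.val ⁻¹' u : Set (zariskiClosure S))).Nonempty :=
    ⟨⟨_, rationalPoints_subset_zariskiClosure hAS ⟨v, hvA, rfl⟩⟩, ⟨v, hvA, rfl⟩, hf _ hfv⟩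
  refine (subset_closure_inter_of_isPreirreducible_of_isOpen hirr.2 ho hmeet).trans ?_
  exact closure_minimal (Set.inter_subset_right.trans hoZ)
    (isClosed_of_mem_irreducibleComponents Z hZ)

/-! ### Blocks of coordinates and the dimension bound -/

/-- The coordinates of a block. -/
def blockCoordinates {d : ℕ} (n : Fin d → ℕ) (j : Fin d) : Finset (Σ j, Fin (n j)) :=
  Finset.univ.filter fun p => p.1 = j

theorem card_blockCoordinates {d : ℕ} (n : Fin d → ℕ) (j : Fin d) :
    (blockCoordinates n j).card = n j := by
  have : blockCoordinates n j = (Finset.univ : Finset (Fin (n j))).map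
      ⟨Sigma.mk j, sigma_mk_injective⟩ := by
    ext ⟨i, k⟩
    simp only [blockCoordinates, Finset.mem_filter, Finset.mem_univ, true_and, Finset.mem_map,
      Function.Embedding.coeFn_mk]
    constructor
    · rintro rfl
      exact ⟨k, rfl⟩
    · rintro ⟨k, h⟩
      exact (congrArg Sigma.fst h).symm
  rw [this, Finset.card_map, Finset.card_fin]

theorem MultidegreeLE.isAffineAlong {K : Type*} [Field K] {d : ℕ} {n : Fin d → ℕ}
    {f : (∀ j, Fin (n j) → K) → K} (hf : MultidegreeLE f fun _ => 1)
    {P : MvPolynomial (Σ j, Fin (n j)) K}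
    (hP : ∀ v, f v = MvPolynomial.eval (flattenPoint v) P) (j : Fin d) :
    IsAffineAlong (blockCoordinates n j) P := by
  intro x
  let v : ∀ j, Fin (n j) → K := fun j k => x ⟨j, k⟩
  obtain ⟨Q, hQ, hfQ⟩ := hf j v
  obtain ⟨a, l, hl⟩ := Q.exists_linearMap_eval_eq_add_of_totalDegree_le_one hQ
  refine ⟨l ∘ₗ LinearMap.funLeft K K fun k => ⟨j, k⟩, fun y hy => ?_⟩
  have hxy : x + y = flattenPoint (Function.update v j fun k => x ⟨j, k⟩ + y ⟨j, k⟩) := by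
    ext ⟨i, k⟩
    by_cases h : i = j
    · subst h
      simp [flattenPoint]
    · rw [Pi.add_apply, hy ⟨i, k⟩ (by simpa [blockCoordinates] using h)]
      simp [flattenPoint, Function.update_of_ne h, v]
  have hx : x = flattenPoint (Function.update v j fun k => x ⟨j, k⟩) := by
    rw [show (fun k => x ⟨j, k⟩) = v j from rfl, Function.update_eq_self]
    rfl
  rw [hxy, ← hP, hfQ, hl]
  conv_rhs => rw [hx, ← hP, hfQ, hl]
  rw [add_assoc, LinearMap.comp_apply, ← map_add]
  rfl

theorem mainTheorem12 {K : Type*} [Field K] [Infinite K] (d m : ℕ) (n : Fin d → ℕ)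
    (G : (∀ j, Fin (n j) → K) → Fin m → K) (hG : IsPolynomialMap G)
    (hdeg : ∀ i : Fin m, MultidegreeLE (fun v => G v i) (fun _ => 1))
    (c : Fin m → K) (hc : (G ⁻¹' {c}).Nonempty) :
    ∀ Z ∈ irreducibleComponents (zariskiClosure (flattenPoint '' (G ⁻¹' {c}))),
      ((∑ j, n j : ℕ) : WithBot ℕ∞) ≤ topologicalKrullDim Z + ((2 ^ d * m : ℕ) : WithBot ℕ∞) := by
  intro Z hZ
  choose P hP using hG
  have hS {x : (Σ j, Fin (n j)) → K} : x ∈ flattenPoint '' (G ⁻¹' {c}) ↔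
      ∀ i, MvPolynomial.eval x (P i) = c i := by
    constructor
    · rintro ⟨v, rfl, rfl⟩ i
      exact (hP i v).symm
    · intro h
      refine ⟨fun j k => x ⟨j, k⟩, ?_, rfl⟩
      ext i
      rw [hP, ← h i]
      rfl
  obtain ⟨v, hv, hvZ⟩ := exists_mem_rationalPoints_subset_of_mem_irreducibleComponents _ Z hZ
  obtain ⟨B, hvB, hB, hBc, -⟩ := exists_hasPrimeChain_of_isAffineAlong P c (blockCoordinates n)
    (fun i j hij => Finset.disjoint_left.2 fun p hi hj => hij <| by
      simp only [blockCoordinates, Finset.mem_filter] at hi hj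
      exact hi.2.symm.trans hj.2)
    (fun j i => (hdeg i).isAffineAlong (hP i) j) v (hS.1 hv) Finset.univ
  have hBS : B ⊆ flattenPoint '' (G ⁻¹' {c}) := fun x hx => hS.2 (hBc x hx)
  have hBZ := hvZ B hBS hvB hB.isPrime
  obtain ⟨Y, -, hY⟩ := hB.exists_le_height (L := AlgebraicClosure K) (X := Z)
    (e := fun z => z.1.1)
    (Topology.IsInducing.subtypeVal.comp Topology.IsInducing.subtypeVal)
    fun x hx => ⟨⟨⟨x, rationalPoints_subset_zariskiClosure hBS hx⟩, hBZ hx⟩, rfl⟩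
  have hdim : ((∑ j, ((blockCoordinates n j).card - m) : ℕ) : WithBot ℕ∞) ≤
      topologicalKrullDim Z :=
    (WithBot.coe_le_coe.2 hY).trans (Order.height_le_krullDim Y)
  -- Truncated subtraction only helps: n_j ≤ (n_j - m) + m also when n_j < m. The total loss is at
  -- most d m ≤ 2^d m.
  have hcount : ∑ j, n j ≤ ∑ j, ((blockCoordinates n j).card - m) + 2 ^ d * m := by
    calc ∑ j, n j ≤ ∑ j, ((blockCoordinates n j).card - m + m) :=
          Finset.sum_le_sum fun j _ => by rw [card_blockCoordinates]; omega
      _ = ∑ j, ((blockCoordinates n j).card - m) + d * m := by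
          simp [Finset.sum_add_distrib]
      _ ≤ _ := Nat.add_le_add_left (Nat.mul_le_mul_right m Nat.lt_two_pow_self.le) _
  calc ((∑ j, n j : ℕ) : WithBot ℕ∞)
      ≤ ((∑ j, ((blockCoordinates n j).card - m) + 2 ^ d * m : ℕ) : WithBot ℕ∞) :=
        Nat.cast_le.2 hcount
    _ ≤ _ := by
        rw [Nat.cast_add]
        gcongr
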